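/- Let $M$ be a complete (connected, second countable, finite-dimensional, smooth) Riemannian manifold, possibly with boundary, with Riemannian distance $d$. Let $r>1$, let $h\colon M\to\mathbb R$ be of class $C^r$ with $0$ as a regular value and $\Sigma:=h^{-1}(0)$ compact, and put $M_+:=\{h>0\}$, $M_-:=\{h<0\}$. Let $Z_+,Z_-$ be $C^r$ vector fields on $M$ such that the multivalued field $$Z(p)=\tfrac12\big(Z_+(p)+Z_-(p)\big)+\tfrac12\operatorname{sgn}(h(p))\big(Z_+(p)-Z_-(p)\big),\qquad \operatorname{sgn}(0):=[-1,1],$$ is bounded: there is $C$ with $\|v\|\le C$ for all $p\in M$ and all values $v$ of $Z$ at $p$. For a vector field $X$ write $Xf(p)=df_p(X(p))$, and let $X^kf$ be the iterated Lie derivative. Let $$\mathcal T:=\{p\in\Sigma: Z_+h(p)\,Z_-h(p)=0\},\qquad \Sigma^{s}:=\{p\in\Sigma: Z_+h(p)\,Z_-h(p)<0\}$$ be the set of tangency points and the sliding region (stable and unstable), and on $\Sigma^s$ let $$Z_s:=\frac{1}{Z_-h-Z_+h}\big(Z_-h\,Z_+-Z_+h\,Z_-\big)$$ be the sliding vector field,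 extended by continuity to those points of $\mathcal T\cap\overline{\Sigma^s}$ at which the limit of $Z_s$ along $\Sigma^s$ exists. A *solution* of $Z$ on a nondegenerate interval $J\subseteq\mathbb R$ is a continuous curve $\gamma\colon J\to M$ such that every compact subinterval $[a,b]$ of $J$ can be cut at finitely many times, those in $(a,b)$ being mapped into $\Sigma$, into intervals on whose interiors $\gamma$ is an integral curve of $Z_+$ contained in $M_+$, or an integral curve of $Z_-$ contained in $M_-$, or an integral curve of the (extended) sliding field $Z_s$. An *orbit* is a solution that is not a restriction of a solution on a strictly larger interval, and the *orbit space* $\widetilde M$ is the set of all orbits. An orbit $\gamma$ whose domain has endpoints $\omega_-<\omega_+$ is extended to a curve $\overline\gamma\colon\mathbb R\to M$ which is constant, equal to $\lim_{t\to\omega_-}\gamma(t)$, before $\omega_-$ if $\omega_->-\infty$, and constant, equal to $\lim_{t\to\omega_+}\gamma(t)$, after $\omega_+$ if $\omega_+<\infty$. The space $\widetilde M$ carries the topology of the distance $$\widetilde d(\gamma_0,\gamma_1)=\sum_{i\in\mathbb Z}\frac1{2^{|i|}}\int_i^{i+1}d\big(\overline\gamma_0(t),\overline\gamma_1(t)\big)\,dt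 .$$ Suppose that $\mathcal T$ is finite and that every $p\in\mathcal T$ has finite multiplicity, i.e. there are integers $m,n\ge2$ (with $m,n\le r$, so that the derivatives exist) such that $Z_+^mh(p)\ne0$ and $Z_-^nh(p)\ne0$. Then $\widetilde M$ is separable. -/

import Mathlib

open Set Filter Topology MeasureTheory
open scoped Manifold ContDiff ENNReal Bundle

noncomputable section

section LieDerivative

variable {E : Type*} [NormedAddCommGroup E] [NormedSpace ℝ E]
  {H : Type*} [TopologicalSpace H] (I : ModelWithCorners ℝ E H)
  {M : Type*} [TopologicalSpace M] [ChartedSpace H M]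

/-- The Lie derivative `X f` of a function `f` in the direction of a vector field `X`:
`X f (p) = df_p (X p) = ⟨∇ f (p), X p⟩`. -/
def lieDerivative (X : (p : M) → TangentSpace I p) (f : M → ℝ) : M → ℝ :=
  fun p => mfderiv I 𝓘(ℝ, ℝ) f p (X p)

/-- The iterated Lie derivative `X ^ k f`. -/
def iteratedLieDerivative (X : (p : M) → TangentSpace I p) (k : ℕ) (f : M → ℝ) : M → ℝ :=
  (lieDerivative I X)^[k] f

end LieDerivative

/-- The multivalued sign function, with value the whole interval `[-1, 1]` at the origin. -/
def multiSign (x : ℝ) : Set ℝ :=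
  if 0 < x then {1} else if x < 0 then {-1} else Icc (-1) 1

/-- A nonsmooth vector field `Z = (Z₊, Z₋)` of class `C ^ r` on `M`, together with the function `h`
(with `0` as a regular value) which generates the compact switching manifold `Σ = h ⁻¹ (0)`. -/
structure FilippovSystem {E : Type*} [NormedAddCommGroup E] [NormedSpace ℝ E]
    {H : Type*} [TopologicalSpace H] (I : ModelWithCorners ℝ E H)
    (M : Type*) [TopologicalSpace M] [ChartedSpace H M] [IsManifold I ∞ M] (r : ℕ∞) where
  /-- the function generating the switching manifold -/
  h : M → ℝ
  contMDiff_h : ContMDiff I 𝓘(ℝ, ℝ) (r : ℕ∞ω) h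
  regular : ∀ p, h p = 0 → mfderiv I 𝓘(ℝ, ℝ) h p ≠ 0
  isCompact_switching : IsCompact {p | h p = 0}
  /-- the vector field `Z₊` -/
  Zpos : (p : M) → TangentSpace I p
  /-- the vector field `Z₋` -/
  Zneg : (p : M) → TangentSpace I p
  contMDiff_Zpos : ContMDiff I I.tangent (r : ℕ∞ω) (fun p => (⟨p, Zpos p⟩ : TangentBundle I M))
  contMDiff_Zneg : ContMDiff I I.tangent (r : ℕ∞ω) (fun p => (⟨p, Zneg p⟩ : TangentBundle I M))

namespace FilippovSystem

section Basic

variable {E : Type*} [NormedAddCommGroup E] [NormedSpace ℝ E]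
  {H : Type*} [TopologicalSpace H] {I : ModelWithCorners ℝ E H}
  {M : Type*} [TopologicalSpace M] [ChartedSpace H M] [IsManifold I ∞ M] {r : ℕ∞}
  (Z : FilippovSystem I M r)

/-- The switching manifold `Σ`. -/
def switching : Set M := {p | Z.h p = 0}

/-- The region `M₊`. -/
def regionPos : Set M := {p | 0 < Z.h p}

/-- The region `M₋`. -/
def regionNeg : Set M := {p | Z.h p < 0}

/-- The multivalued field
`Z(p) = (Z₊(p) + Z₋(p)) / 2 + sgn(h(p)) (Z₊(p) - Z₋(p)) / 2`, as the set of its values at `p`. -/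
def values (p : M) : Set (TangentSpace I p) :=
  {v | ∃ s ∈ multiSign (Z.h p),
    v = (1 / 2 : ℝ) • (Z.Zpos p + Z.Zneg p) + (s / 2) • (Z.Zpos p - Z.Zneg p)}

/-- The first Lie derivative `Z₊ h`. -/
def liePos : M → ℝ := lieDerivative I Z.Zpos Z.h

/-- The first Lie derivative `Z₋ h`. -/
def lieNeg : M → ℝ := lieDerivative I Z.Zneg Z.h

/-- The set of tangency points. -/
def tangency : Set M := {p | p ∈ Z.switching ∧ Z.liePos p * Z.lieNeg p = 0}

/-- The sliding region (the union of the stable and the unstable sliding regions). -/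
def sliding : Set M := {p | p ∈ Z.switching ∧ Z.liePos p * Z.lieNeg p < 0}

/-- Finite multiplicity of a tangency point. The orders are at most the class of smoothness `r`, so
that the iterated Lie derivatives exist. -/
def FiniteMultiplicity (p : M) : Prop :=
  (∃ m : ℕ, 2 ≤ m ∧ (m : ℕ∞) ≤ r ∧ iteratedLieDerivative I Z.Zpos m Z.h p ≠ 0) ∧
  (∃ n : ℕ, 2 ≤ n ∧ (n : ℕ∞) ≤ r ∧ iteratedLieDerivative I Z.Zneg n Z.h p ≠ 0)

/-- The sliding vector field `Z_s`; it is only meaningful on the sliding region. -/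
def slidingField (p : M) : TangentSpace I p :=
  (1 / (Z.lieNeg p - Z.liePos p)) • (Z.lieNeg p • Z.Zpos p - Z.liePos p • Z.Zneg p)

/-- `v` is the value at `p` of the sliding vector field, extended by continuity to those tangency
points in the closure of the sliding region at which the limit exists. -/
def IsSlidingValue (p : M) (v : TangentSpace I p) : Prop :=
  (p ∈ Z.sliding ∧ v = Z.slidingField p) ∨
  (p ∈ Z.tangency ∧ p ∈ closure Z.sliding ∧
    Tendsto (fun q => (⟨q, Z.slidingField q⟩ : TangentBundle I M)) (𝓝[Z.sliding] p)
      (𝓝 (⟨p, v⟩ : TangentBundle I M)))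

/-- On the open interval `J`, the curve `g` is a single smooth piece of a solution: an integral
curve of `Z₊` in `M₊`, or of `Z₋` in `M₋`, or of the (extended) sliding vector field. -/
def IsPiece (g : ℝ → M) (J : Set ℝ) : Prop :=
  (MapsTo g J Z.regionPos ∧ IsMIntegralCurveOn g Z.Zpos J) ∨
  (MapsTo g J Z.regionNeg ∧ IsMIntegralCurveOn g Z.Zneg J) ∨
  (∀ t ∈ J, ∃ v : TangentSpace I (g t), Z.IsSlidingValue (g t) v ∧
    HasMFDerivAt 𝓘(ℝ, ℝ) I g t ((1 : ℝ →L[ℝ] ℝ).smulRight v))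

/-- `g` is a Filippov solution on the nondegenerate interval `s`: it is continuous there, and on
every compact subinterval `[a, b]` it is the concatenation of finitely many smooth pieces, glued to
each other at points of the switching manifold. Values of `g` outside `s` are irrelevant. -/
structure IsSolutionOn (g : ℝ → M) (s : Set ℝ) : Prop where
  ordConnected : s.OrdConnected
  nontrivial : s.Nontrivial
  continuousOn : ContinuousOn g s
  pieces : ∀ a ∈ s, ∀ b ∈ s, a < b → ∃ F : Finset ℝ,
    (∀ t ∈ F, t ∈ Ioo a b → g t ∈ Z.switching) ∧
    ∀ c d, c < d → Ioo c d ⊆ Ioo a b → Disjoint (F : Set ℝ) (Ioo c d) → Z.IsPiece g (Ioo c d)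

/-- A solution which is not the restriction of a solution on a strictly larger interval. -/
def IsMaximalSolutionOn (g : ℝ → M) (s : Set ℝ) : Prop :=
  Z.IsSolutionOn g s ∧
    ∀ (g' : ℝ → M) (s' : Set ℝ), Z.IsSolutionOn g' s' → s ⊆ s' → EqOn g g' s → s' = s

/-- The orbit space: the set of all orbits of `Z`, that is, of all Filippov solutions defined on
their maximal interval of existence. -/
@[ext]
structure OrbitSpace where
  /-- the maximal domain of the orbit -/
  domain : Set ℝ
  /-- the orbit itself -/
  curve : domain → M
  exists_maximal : ∃ g : ℝ → M, (∀ t : domain, curve t = g t) ∧ Z.IsMaximalSolutionOn g domain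

end Basic

section Bounded

variable {E : Type*} [NormedAddCommGroup E] [NormedSpace ℝ E]
  {H : Type*} [TopologicalSpace H] {I : ModelWithCorners ℝ E H}
  {M : Type*} [TopologicalSpace M] [ChartedSpace H M] [IsManifold I ∞ M] {r : ℕ∞}
  [Bundle.RiemannianBundle (fun p : M => TangentSpace I p)]

/-- The field `Z` is bounded in the norm of the Riemannian metric. -/
def IsBounded (Z : FilippovSystem I M r) : Prop :=
  ∃ C : ℝ, ∀ p, ∀ v ∈ Z.values p, ‖v‖ ≤ C

end Bounded

namespace OrbitSpace

section Extension

variable {E : Type*} [NormedAddCommGroup E] [NormedSpace ℝ E]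
  {H : Type*} [TopologicalSpace H] {I : ModelWithCorners ℝ E H}
  {M : Type*} [TopologicalSpace M] [ChartedSpace H M] [IsManifold I ∞ M] {r : ℕ∞}
  {Z : FilippovSystem I M r}

theorem nonempty_target (γ : Z.OrbitSpace) : Nonempty M := by
  obtain ⟨g, -, -⟩ := γ.exists_maximal
  exact ⟨g 0⟩

open Classical in
/-- The extension of an orbit to all of `ℝ`: it rests at the limit point `x_{ω₋}` before the left
endpoint `ω₋` of the domain, and at the limit point `x_{ω₊}` after the right endpoint `ω₊`. -/
def extend (γ : Z.OrbitSpace) (t : ℝ) : M :=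
  haveI : Nonempty M := γ.nonempty_target
  if ht : t ∈ γ.domain then γ.curve ⟨t, ht⟩
  else if ∀ s ∈ γ.domain, t < s then
    limUnder (comap ((↑) : γ.domain → ℝ) (𝓝 (sInf γ.domain))) γ.curve
  else limUnder (comap ((↑) : γ.domain → ℝ) (𝓝 (sSup γ.domain))) γ.curve

end Extension

section Distance

variable {E : Type*} [NormedAddCommGroup E] [NormedSpace ℝ E]
  {H : Type*} [TopologicalSpace H] {I : ModelWithCorners ℝ E H}
  {M : Type*} [MetricSpace M] [ChartedSpace H M] [IsManifold I ∞ M] {r : ℕ∞}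
  {Z : FilippovSystem I M r}

/-- The integral distance
`∑_{i ∈ ℤ} 2 ^ (-|i|) ∫_i^{i+1} d(γ₀(t), γ₁(t)) dt`, with values in `[0, ∞]` so that it is
meaningful without convergence assumptions. -/
def integralDist (γ₀ γ₁ : Z.OrbitSpace) : ℝ≥0∞ :=
  ∑' i : ℤ, (2 ^ i.natAbs : ℝ≥0∞)⁻¹ *
    ∫⁻ t in Ioc (i : ℝ) (i + 1), edist (γ₀.extend t) (γ₁.extend t)

theorem measurable_extend [MeasurableSpace M] [BorelSpace M] (γ : Z.OrbitSpace) :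
    Measurable γ.extend := by
  classical
  obtain ⟨g, hg, hs, -⟩ := γ.exists_maximal
  have : Nonempty M := γ.nonempty_target
  have hm : MeasurableSet γ.domain := hs.ordConnected.measurableSet
  have hL : MeasurableSet {t : ℝ | ∀ s ∈ γ.domain, t < s} := by
    refine Set.OrdConnected.measurableSet ⟨fun a _ b hb c hc s hsd => ?_⟩
    exact lt_of_le_of_lt hc.2 (hb s hsd)
  set x := limUnder (comap ((↑) : γ.domain → ℝ) (𝓝 (sInf γ.domain))) γ.curve
  set y := limUnder (comap ((↑) : γ.domain → ℝ) (𝓝 (sSup γ.domain))) γ.curve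
  set e : ℝ → M := {t : ℝ | ∀ s ∈ γ.domain, t < s}.piecewise (fun _ => x) (fun _ => y)
  have he : Measurable e := Measurable.piecewise hL measurable_const measurable_const
  have hγ : γ.extend = fun t => if t ∈ γ.domain then g t else e t := by
    funext t
    by_cases ht : t ∈ γ.domain
    · simp only [extend, dif_pos ht, if_pos ht, hg]
    · simp only [extend, dif_neg ht, if_neg ht, e, Set.piecewise, x, y, Set.mem_ofPred_eq]
  rw [hγ]
  refine measurable_of_restrict_of_restrict_compl hm ?_ ?_
  · have : γ.domain.domRestrict (fun t => if t ∈ γ.domain then g t else e t)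
        = γ.domain.domRestrict g := by
      funext t; simp [t.2]
    rw [this]
    exact hs.continuousOn.domRestrict.measurable
  · have : γ.domainᶜ.domRestrict (fun t => if t ∈ γ.domain then g t else e t)
        = γ.domainᶜ.domRestrict e := by
      funext t
      have h2 : (t : ℝ) ∉ γ.domain := t.2
      simp [h2]
    rw [this]
    exact he.comp measurable_subtype_coe

/-- The orbit space carries the integral distance. -/
instance [SecondCountableTopology M] : PseudoEMetricSpace Z.OrbitSpace where
  edist := integralDist
  edist_self γ := by
    simp [integralDist]
  edist_comm γ₀ γ₁ := by
    simp only [integralDist, edist_comm]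
  edist_triangle γ₀ γ₁ γ₂ := by
    borelize M
    unfold integralDist
    rw [← ENNReal.tsum_add]
    refine ENNReal.tsum_le_tsum fun i => ?_
    rw [← mul_add, ← lintegral_add_left
      ((measurable_extend γ₀).edist (measurable_extend γ₁))]
    gcongr
    exact edist_triangle _ _ _

end Distance

end OrbitSpace

end FilippovSystem

end

noncomputable section

section CurveLength

variable {E : Type*} [NormedAddCommGroup E] [NormedSpace ℝ E]
  {H : Type*} [TopologicalSpace H] {I : ModelWithCorners ℝ E H}

theorem HasMFDerivAt.hasDerivAt_extChartAt_comp
    {M : Type*} [TopologicalSpace M] [ChartedSpace H M] [IsManifold I 1 M]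
    {g : ℝ → M} {t : ℝ} {x : M} {v : TangentSpace I (g t)}
    (hg : HasMFDerivAt 𝓘(ℝ, ℝ) I g t ((1 : ℝ →L[ℝ] ℝ).smulRight v))
    (hsrc : g t ∈ (chartAt H x).source) :
    HasDerivAt (extChartAt I x ∘ g) (tangentCoordChange I (g t) x (g t) v) t := by
  have h1 : HasDerivAt (extChartAt I (g t) ∘ g) v t := by
    have h : HasFDerivAt (extChartAt I (g t) ∘ g) ((1 : ℝ →L[ℝ] ℝ).smulRight v : ℝ →L[ℝ] E) t :=
      hg.2.hasFDerivAt (by simp)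
    exact h
  have h2 := hasFDerivWithinAt_tangentCoordChange (I := I) (x := g t) (y := x) (z := g t)
    ⟨mem_extChartAt_source _, by rwa [extChartAt_source]⟩
  have h3 := h2.comp_hasDerivAt t h1 (Eventually.of_forall fun s => by simp [extChartAt])
  refine h3.congr_of_eventuallyEq ?_
  filter_upwards [hg.continuousAt.preimage_mem_nhds (extChartAt_source_mem_nhds (I := I) (g t))]
    with s hs
  simp only [Function.comp_apply, (extChartAt I (g t)).left_inv hs]

theorem contMDiffOn_one_of_hasMFDerivAt
    {M : Type*} [TopologicalSpace M] [ChartedSpace H M] [IsManifold I 1 M]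
    {g : ℝ → M} {J : Set ℝ} (hJ : IsOpen J) {v : ∀ t, TangentSpace I (g t)}
    (hg : ∀ t ∈ J, HasMFDerivAt 𝓘(ℝ, ℝ) I g t ((1 : ℝ →L[ℝ] ℝ).smulRight (v t)))
    (hv : ContinuousOn (fun t => (⟨g t, v t⟩ : TangentBundle I M)) J) :
    ContMDiffOn 𝓘(ℝ, ℝ) I 1 g J := by
  intro t₀ ht₀
  refine ContMDiffAt.contMDiffWithinAt ?_
  rw [contMDiffAt_iff_target]
  have hc : ContinuousOn g J := fun t ht => (hg t ht).continuousAt.continuousWithinAt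
  refine ⟨(hg t₀ ht₀).continuousAt, ?_⟩
  rw [contMDiffAt_iff_contDiffAt, contDiffAt_one_iff]
  set U : Set ℝ := J ∩ g ⁻¹' (chartAt H (g t₀)).source
  have hU : IsOpen U := hc.isOpen_inter_preimage hJ (chartAt H (g t₀)).open_source
  refine ⟨fun t => (1 : ℝ →L[ℝ] ℝ).smulRight
    (trivializationAt E (TangentSpace I) (g t₀) ⟨g t, v t⟩).2, U,
    hU.mem_nhds ⟨ht₀, mem_chart_source _ _⟩, ?_, ?_⟩
  · have h1 : ContinuousOn (fun t => (trivializationAt E (TangentSpace I) (g t₀)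
        (⟨g t, v t⟩ : TangentBundle I M)).2) U := by
      refine continuous_snd.comp_continuousOn
        ((trivializationAt E (TangentSpace I) (g t₀)).continuousOn.comp
          (hv.mono inter_subset_left) ?_)
      intro t ht
      rw [Bundle.Trivialization.mem_source]
      exact ht.2
    exact (ContinuousLinearMap.smulRightL ℝ ℝ E (1 : ℝ →L[ℝ] ℝ)).continuous.comp_continuousOn h1
  · intro t ht
    exact (hg t ht.1).hasDerivAt_extChartAt_comp ht.2

variable {M : Type*} [MetricSpace M] [ChartedSpace H M] [IsManifold I 1 M]
  [Bundle.RiemannianBundle (fun p : M => TangentSpace I p)] [IsRiemannianManifold I M]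

theorem lipschitzOnWith_of_norm_velocity_le
    {g : ℝ → M} {J : Set ℝ} (hJ : IsOpen J) (hJc : J.OrdConnected)
    {v : ∀ t, TangentSpace I (g t)} {C : NNReal}
    (hg : ∀ t ∈ J, HasMFDerivAt 𝓘(ℝ, ℝ) I g t ((1 : ℝ →L[ℝ] ℝ).smulRight (v t)))
    (hv : ContinuousOn (fun t => (⟨g t, v t⟩ : TangentBundle I M)) J)
    (hC : ∀ t ∈ J, ‖v t‖ ≤ C) :
    LipschitzOnWith C g J := by
  have key : ∀ x ∈ J, ∀ y ∈ J, x ≤ y → edist (g x) (g y) ≤ C * edist x y := by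
    intro x hx y hy hxy
    have hsub : Icc x y ⊆ J := hJc.out hx hy
    rw [IsRiemannianManifold.out (I := I) (g x) (g y)]
    refine (Manifold.riemannianEDist_le_pathELength
      ((contMDiffOn_one_of_hasMFDerivAt hJ hg hv).mono hsub) rfl rfl hxy).trans ?_
    rw [Manifold.pathELength_eq_lintegral_mfderiv_Icc]
    calc _ ≤ ∫⁻ _ in Icc x y, (C : ℝ≥0∞) := by
            refine setLIntegral_mono measurable_const fun t ht => ?_
            rw [(hg t (hsub ht)).mfderiv]
            have h2 : ((1 : ℝ →L[ℝ] ℝ).smulRight (v t) : ℝ →L[ℝ] TangentSpace I (g t)) 1 = v t := by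
              simp
            erw [h2]
            rw [← ofReal_norm, ← ENNReal.ofReal_coe_nnreal]
            exact ENNReal.ofReal_le_ofReal (hC t (hsub ht))
      _ = C * edist x y := by
            rw [setLIntegral_const, Real.volume_Icc, edist_comm, edist_dist, Real.dist_eq,
              abs_of_nonneg (sub_nonneg.2 hxy)]
  intro x hx y hy
  rcases le_total x y with h | h
  · exact key x hx y hy h
  · rw [edist_comm, edist_comm x]; exact key y hy x hx h

end CurveLength

theorem lipschitzOnWith_Icc_of_finset_pieces {X : Type*} [PseudoMetricSpace X] {C : NNReal}
    {g : ℝ → X} (F : Finset ℝ) : ∀ {a b : ℝ}, a < b → ContinuousOn g (Icc a b) →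
    (∀ c d, c < d → Ioo c d ⊆ Ioo a b → Disjoint (F : Set ℝ) (Ioo c d) →
      LipschitzOnWith C g (Ioo c d)) →
    edist (g a) (g b) ≤ C * edist a b := by
  classical
  induction F using Finset.induction_on with
  | empty =>
    intro a b hab hg h
    have h1 := h a b hab Subset.rfl (by simp)
    rw [← closure_Ioo hab.ne] at hg
    have h2 := LipschitzOnWith.closure hg h1
    rw [closure_Ioo hab.ne] at h2
    exact h2 (left_mem_Icc.2 hab.le) (right_mem_Icc.2 hab.le)
  | insert p F hp ih =>
    intro a b hab hg h
    by_cases hpab : p ∈ Ioo a b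
    · have h1 := ih hpab.1 (hg.mono (Icc_subset_Icc_right hpab.2.le)) (fun c d hcd hs hd =>
        h c d hcd (hs.trans (Ioo_subset_Ioo_right hpab.2.le)) (by
          rw [Finset.coe_insert, disjoint_insert_left]
          exact ⟨fun hm => lt_irrefl p (hs hm).2, hd⟩))
      have h2 := ih hpab.2 (hg.mono (Icc_subset_Icc_left hpab.1.le)) (fun c d hcd hs hd =>
        h c d hcd (hs.trans (Ioo_subset_Ioo_left hpab.1.le)) (by
          rw [Finset.coe_insert, disjoint_insert_left]
          exact ⟨fun hm => lt_irrefl p (hs hm).1, hd⟩))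
      refine (edist_triangle _ (g p) _).trans ((add_le_add h1 h2).trans_eq ?_)
      rw [← mul_add]
      congr 1
      simp only [edist_dist, Real.dist_eq]
      rw [← ENNReal.ofReal_add (abs_nonneg _) (abs_nonneg _), abs_sub_comm a p, abs_sub_comm p b,
        abs_sub_comm a b, abs_of_pos (sub_pos.2 hpab.1), abs_of_pos (sub_pos.2 hpab.2),
        abs_of_pos (sub_pos.2 hab)]
      congr 1; ring
    · exact ih hab hg (fun c d hcd hs hd => h c d hcd hs (by
        rw [Finset.coe_insert, disjoint_insert_left]
        exact ⟨fun hm => hpab (hs hm), hd⟩))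

theorem FiberBundle.eq_of_tendsto_mk {B F α : Type*} [TopologicalSpace B] [TopologicalSpace F]
    [T2Space F] {V : B → Type*} [TopologicalSpace (Bundle.TotalSpace F V)]
    [∀ b, TopologicalSpace (V b)] [FiberBundle F V] {l : Filter α} [l.NeBot]
    {f : α → Bundle.TotalSpace F V} {b : B} {v w : V b}
    (hv : Tendsto f l (𝓝 ⟨b, v⟩)) (hw : Tendsto f l (𝓝 ⟨b, w⟩)) : v = w := by
  set e := trivializationAt F V b
  have hs : ∀ u : V b, (⟨b, u⟩ : Bundle.TotalSpace F V) ∈ e.source := fun u =>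
    FiberBundle.mem_trivializationAt_proj_source (x := (⟨b, u⟩ : Bundle.TotalSpace F V))
  have h := tendsto_nhds_unique
    ((continuous_snd.tendsto _).comp ((e.continuousAt (hs v)).tendsto.comp hv))
    ((continuous_snd.tendsto _).comp ((e.continuousAt (hs w)).tendsto.comp hw))
  have h' := e.injOn (hs v) (hs w)
    (Prod.ext ((e.coe_fst (hs v)).trans (e.coe_fst (hs w)).symm) h)
  simpa using h'

section LieDerivative

variable {E : Type*} [NormedAddCommGroup E] [NormedSpace ℝ E]
  {H : Type*} [TopologicalSpace H] {I : ModelWithCorners ℝ E H}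
  {M : Type*} [TopologicalSpace M] [ChartedSpace H M] [IsManifold I ∞ M]

theorem continuous_lieDerivative {X : (p : M) → TangentSpace I p} {f : M → ℝ}
    (hX : Continuous (fun p => (⟨p, X p⟩ : TangentBundle I M))) (hf : ContMDiff I 𝓘(ℝ, ℝ) 1 f) :
    Continuous (lieDerivative I X f) := by
  have h1 : Continuous (fun p => tangentMap I 𝓘(ℝ, ℝ) f ⟨p, X p⟩) :=
    (hf.continuous_tangentMap le_rfl).comp hX
  exact continuous_snd.comp ((tangentBundleModelSpaceHomeomorph 𝓘(ℝ, ℝ)).continuous.comp h1)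

end LieDerivative

namespace FilippovSystem

section SlidingExtension

variable {E : Type*} [NormedAddCommGroup E] [NormedSpace ℝ E]
  {H : Type*} [TopologicalSpace H] {I : ModelWithCorners ℝ E H}
  {M : Type*} [TopologicalSpace M] [ChartedSpace H M] [IsManifold I ∞ M] {r : ℕ∞}
  (Z : FilippovSystem I M r)

theorem continuous_liePos (hr : 1 ≤ r) : Continuous Z.liePos :=
  continuous_lieDerivative Z.contMDiff_Zpos.continuous (Z.contMDiff_h.of_le (by exact_mod_cast hr))

theorem continuous_lieNeg (hr : 1 ≤ r) : Continuous Z.lieNeg :=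
  continuous_lieDerivative Z.contMDiff_Zneg.continuous (Z.contMDiff_h.of_le (by exact_mod_cast hr))

theorem lieNeg_sub_liePos_ne_zero {p : M} (hp : p ∈ Z.sliding) : Z.lieNeg p - Z.liePos p ≠ 0 := by
  intro h
  have h1 := hp.2
  rw [sub_eq_zero] at h
  rw [h] at h1
  exact absurd h1 (not_lt.2 (mul_self_nonneg _))

theorem continuousOn_slidingField (hr : 1 ≤ r) :
    ContinuousOn (fun p => (⟨p, Z.slidingField p⟩ : TangentBundle I M)) Z.sliding := by
  have hP : ContMDiffOn I 𝓘(ℝ, ℝ) 0 Z.liePos Z.sliding :=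
    contMDiffOn_zero_iff.2 (Z.continuous_liePos hr).continuousOn
  have hN : ContMDiffOn I 𝓘(ℝ, ℝ) 0 Z.lieNeg Z.sliding :=
    contMDiffOn_zero_iff.2 (Z.continuous_lieNeg hr).continuousOn
  have hD : ContMDiffOn I 𝓘(ℝ, ℝ) 0 (fun p => 1 / (Z.lieNeg p - Z.liePos p)) Z.sliding := by
    refine contMDiffOn_zero_iff.2 (continuousOn_const.div ?_ fun p => Z.lieNeg_sub_liePos_ne_zero)
    exact ((Z.continuous_lieNeg hr).sub (Z.continuous_liePos hr)).continuousOn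
  have hp := (Z.contMDiff_Zpos.of_le zero_le).contMDiffOn (s := Z.sliding)
  have hn := (Z.contMDiff_Zneg.of_le zero_le).contMDiffOn (s := Z.sliding)
  exact (hD.smul_section ((hN.smul_section hp).sub_section (hP.smul_section hn))).continuousOn

theorem not_mem_tangency_of_mem_sliding {p : M} (hp : p ∈ Z.sliding) : p ∉ Z.tangency :=
  fun h => hp.2.ne h.2

theorem IsSlidingValue.eq_slidingField {p : M} (hp : p ∈ Z.sliding) {v : TangentSpace I p}
    (hv : Z.IsSlidingValue p v) : v = Z.slidingField p := by
  rcases hv with hv | hv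
  · exact hv.2
  · exact absurd hv.1 (Z.not_mem_tangency_of_mem_sliding hp)

theorem IsSlidingValue.mem_closure {p : M} {v : TangentSpace I p}
    (hv : Z.IsSlidingValue p v) : p ∈ closure Z.sliding := by
  rcases hv with hv | hv
  · exact subset_closure hv.1
  · exact hv.2.1

theorem IsSlidingValue.tendsto (hr : 1 ≤ r) {p : M} {v : TangentSpace I p}
    (hv : Z.IsSlidingValue p v) :
    Tendsto (fun q => (⟨q, Z.slidingField q⟩ : TangentBundle I M)) (𝓝[Z.sliding] p)
      (𝓝 (⟨p, v⟩ : TangentBundle I M)) := by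
  rcases hv with ⟨hp, rfl⟩ | hv
  · exact Z.continuousOn_slidingField hr p hp
  · exact hv.2.2

theorem IsSlidingValue.unique (hr : 1 ≤ r) {p : M} {v w : TangentSpace I p}
    (hv : Z.IsSlidingValue p v) (hw : Z.IsSlidingValue p w) : v = w :=
  have : (𝓝[Z.sliding] p).NeBot := mem_closure_iff_nhdsWithin_neBot.1 (hv.mem_closure)
  FiberBundle.eq_of_tendsto_mk (hv.tendsto _ hr) (hw.tendsto _ hr)

/-- The points at which the extended sliding vector field is defined. -/
def slidingDomain : Set M := {p | ∃ v, Z.IsSlidingValue p v}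

open Classical in
/-- The sliding vector field, extended by continuity. -/
def slidingExtension (p : M) : TangentSpace I p :=
  if h : ∃ v, Z.IsSlidingValue p v then h.choose else 0

theorem isSlidingValue_slidingExtension {p : M} (hp : p ∈ Z.slidingDomain) :
    Z.IsSlidingValue p (Z.slidingExtension p) := by
  have h : ∃ v, Z.IsSlidingValue p v := hp
  rw [slidingExtension, dif_pos h]
  exact h.choose_spec

theorem slidingExtension_eq_slidingField {p : M} (hp : p ∈ Z.sliding) :
    Z.slidingExtension p = Z.slidingField p :=
  (Z.isSlidingValue_slidingExtension ⟨_, Or.inl ⟨hp, rfl⟩⟩).eq_slidingField _ hp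

theorem tendsto_slidingExtension (hr : 1 ≤ r) {p : M} (hp : p ∈ Z.slidingDomain) :
    Tendsto (fun q => (⟨q, Z.slidingExtension q⟩ : TangentBundle I M)) (𝓝[Z.sliding] p)
      (𝓝 (⟨p, Z.slidingExtension p⟩ : TangentBundle I M)) := by
  refine ((Z.isSlidingValue_slidingExtension hp).tendsto _ hr).congr' ?_
  filter_upwards [self_mem_nhdsWithin] with q hq
  rw [Z.slidingExtension_eq_slidingField hq]

theorem continuousOn_slidingExtension [T1Space M] (hr : 1 ≤ r) (hfin : Z.tangency.Finite) :
    ContinuousOn (fun p => (⟨p, Z.slidingExtension p⟩ : TangentBundle I M)) Z.slidingDomain := by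
  intro p hp
  have hle : 𝓝[Z.slidingDomain] p ≤ 𝓝[insert p Z.sliding] p := by
    refine nhdsWithin_le_iff.2 ?_
    have hV : (Z.tangency \ {p})ᶜ ∈ 𝓝 p :=
      (hfin.subset sdiff_subset).isClosed.isOpen_compl.mem_nhds fun h => h.2 rfl
    filter_upwards [self_mem_nhdsWithin, mem_nhdsWithin_of_mem_nhds hV] with q hq hqV
    obtain ⟨v, hv | hv⟩ := hq
    · exact Or.inr hv.1
    · by_contra hqp
      exact hqV ⟨hv.1, fun h => hqp (Or.inl h)⟩
  refine Tendsto.mono_left ?_ hle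
  rw [nhdsWithin_insert]
  exact (tendsto_pure_nhds _ _).sup (Z.tendsto_slidingExtension hr hp)

theorem Zpos_mem_values {p : M} (hp : p ∈ Z.regionPos) : Z.Zpos p ∈ Z.values p := by
  have hp' : 0 < Z.h p := hp
  refine ⟨1, by simp [multiSign, hp'], ?_⟩
  module

theorem Zneg_mem_values {p : M} (hp : p ∈ Z.regionNeg) : Z.Zneg p ∈ Z.values p := by
  have hp' : Z.h p < 0 := hp
  refine ⟨-1, by simp [multiSign, hp', not_lt.2 hp'.le], ?_⟩
  module

theorem slidingField_mem_values {p : M} (hp : p ∈ Z.sliding) : Z.slidingField p ∈ Z.values p := by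
  have h0 : Z.h p = 0 := hp.1
  have hne := Z.lieNeg_sub_liePos_ne_zero hp
  have h1 := hp.2
  set a := Z.liePos p
  set b := Z.lieNeg p
  refine ⟨(b + a) / (b - a), ?_, ?_⟩
  · have : |(b + a) / (b - a)| ≤ 1 := by
      rw [abs_div, div_le_one (abs_pos.2 hne), ← sq_le_sq]
      nlinarith
    simpa [multiSign, h0] using abs_le.1 this
  · simp only [slidingField, smul_sub, smul_add, smul_smul]
    have e1 : 1 / (b - a) * b = 1 / 2 + (b + a) / (b - a) / 2 := by field_simp; ring
    have e2 : 1 / (b - a) * a = (b + a) / (b - a) / 2 - 1 / 2 := by field_simp; ring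
    change (1 / (b - a) * b) • Z.Zpos p - (1 / (b - a) * a) • Z.Zneg p = _
    rw [e1, e2]
    module

end SlidingExtension

section Speed

variable {E : Type*} [NormedAddCommGroup E] [NormedSpace ℝ E]
  {H : Type*} [TopologicalSpace H] {I : ModelWithCorners ℝ E H}
  {M : Type*} [MetricSpace M] [ChartedSpace H M] [IsManifold I ∞ M]
  [Bundle.RiemannianBundle (fun p : M => TangentSpace I p)]
  [IsContMDiffRiemannianBundle I ∞ E (fun p : M => TangentSpace I p)]
  {r : ℕ∞} (Z : FilippovSystem I M r)

theorem norm_slidingExtension_le {C : ℝ}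
    (hC : ∀ p, ∀ v ∈ Z.values p, ‖v‖ ≤ C) (hr : 1 ≤ r) (hfin : Z.tangency.Finite) {p : M}
    (hp : p ∈ Z.slidingDomain) : ‖Z.slidingExtension p‖ ≤ C := by
  have : IsContinuousRiemannianBundle E (fun p : M => TangentSpace I p) := by
    obtain ⟨g, hg, hg'⟩ := IsContMDiffRiemannianBundle.exists_contMDiff (IB := I) (n := ∞) (F := E)
      (E := fun p : M => TangentSpace I p)
    exact ⟨g, hg.continuous, hg'⟩
  have hcont := Z.continuousOn_slidingExtension hr hfin
  have h1 := hcont.inner_bundle hcont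
  have h2 : Tendsto (fun q => ‖Z.slidingExtension q‖) (𝓝[Z.sliding] p)
      (𝓝 ‖Z.slidingExtension p‖) := by
    have h3 := ((h1 p hp).tendsto.mono_left (nhdsWithin_mono p
      (show Z.sliding ⊆ Z.slidingDomain from fun q hq => ⟨_, Or.inl ⟨hq, rfl⟩⟩))).sqrt
    simpa only [real_inner_self_eq_norm_sq, Real.sqrt_sq (norm_nonneg _)] using h3
  have : (𝓝[Z.sliding] p).NeBot := mem_closure_iff_nhdsWithin_neBot.1
    ((Z.isSlidingValue_slidingExtension hp).mem_closure)
  refine le_of_tendsto h2 ?_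
  filter_upwards [self_mem_nhdsWithin] with q hq
  rw [Z.slidingExtension_eq_slidingField hq]
  exact hC q _ (Z.slidingField_mem_values hq)

end Speed

end FilippovSystem

namespace FilippovSystem

section Lipschitz

variable {E : Type*} [NormedAddCommGroup E] [NormedSpace ℝ E]
  {H : Type*} [TopologicalSpace H] {I : ModelWithCorners ℝ E H}
  {M : Type*} [MetricSpace M] [ChartedSpace H M] [IsManifold I ∞ M]
  [Bundle.RiemannianBundle (fun p : M => TangentSpace I p)]
  [IsContMDiffRiemannianBundle I ∞ E (fun p : M => TangentSpace I p)]
  [IsRiemannianManifold I M] {r : ℕ∞} {Z : FilippovSystem I M r} {C : NNReal}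

theorem IsPiece.lipschitzOnWith (hC : ∀ p, ∀ v ∈ Z.values p, ‖v‖ ≤ C) (hr : 1 ≤ r)
    (hfin : Z.tangency.Finite) {g : ℝ → M} {J : Set ℝ} (hJ : IsOpen J) (hJc : J.OrdConnected)
    (hg : Z.IsPiece g J) : LipschitzOnWith C g J := by
  have : IsManifold I 1 M := IsManifold.of_le (n := ∞) (by norm_cast)
  rcases hg with ⟨hm, hg⟩ | ⟨hm, hg⟩ | hg
  · refine lipschitzOnWith_of_norm_velocity_le hJ hJc (v := fun t => Z.Zpos (g t))
      (fun t ht => (hg t ht).hasMFDerivAt (hJ.mem_nhds ht))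
      (Z.contMDiff_Zpos.continuous.comp_continuousOn hg.continuousOn) fun t ht => ?_
    exact hC _ _ (Z.Zpos_mem_values (hm ht))
  · refine lipschitzOnWith_of_norm_velocity_le hJ hJc (v := fun t => Z.Zneg (g t))
      (fun t ht => (hg t ht).hasMFDerivAt (hJ.mem_nhds ht))
      (Z.contMDiff_Zneg.continuous.comp_continuousOn hg.continuousOn) fun t ht => ?_
    exact hC _ _ (Z.Zneg_mem_values (hm ht))
  · have hm : MapsTo g J Z.slidingDomain := fun t ht =>
      let ⟨v, hv, _⟩ := hg t ht
      ⟨v, hv⟩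
    have hg' : ∀ t ∈ J, HasMFDerivAt 𝓘(ℝ, ℝ) I g t
        ((1 : ℝ →L[ℝ] ℝ).smulRight (Z.slidingExtension (g t))) := by
      intro t ht
      obtain ⟨v, hv, hd⟩ := hg t ht
      rwa [hv.unique Z hr (Z.isSlidingValue_slidingExtension (hm ht))] at hd
    exact lipschitzOnWith_of_norm_velocity_le hJ hJc (v := fun t => Z.slidingExtension (g t)) hg'
      ((Z.continuousOn_slidingExtension hr hfin).comp
        (fun t ht => (hg' t ht).continuousAt.continuousWithinAt) hm)
      fun t ht => Z.norm_slidingExtension_le hC hr hfin (hm ht)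

theorem IsSolutionOn.lipschitzOnWith (hC : ∀ p, ∀ v ∈ Z.values p, ‖v‖ ≤ C) (hr : 1 ≤ r)
    (hfin : Z.tangency.Finite) {g : ℝ → M} {s : Set ℝ} (hg : Z.IsSolutionOn g s) :
    LipschitzOnWith C g s := by
  have key : ∀ a ∈ s, ∀ b ∈ s, a < b → edist (g a) (g b) ≤ C * edist a b := by
    intro a ha b hb hab
    obtain ⟨F, -, hF⟩ := hg.pieces a ha b hb hab
    exact lipschitzOnWith_Icc_of_finset_pieces F hab
      (hg.continuousOn.mono (hg.ordConnected.out ha hb))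
      fun c d hcd hs hd => (hF c d hcd hs hd).lipschitzOnWith hC hr hfin isOpen_Ioo ordConnected_Ioo
  intro a ha b hb
  rcases lt_trichotomy a b with h | rfl | h
  · exact key a ha b hb h
  · simp
  · rw [edist_comm, edist_comm a]; exact key b hb a ha h

end Lipschitz

end FilippovSystem

theorem exists_countable_forall_mem_closure_image {α β : Type*} [TopologicalSpace β]
    [SecondCountableTopology β] (f : α → β) :
    ∃ D : Set α, D.Countable ∧ ∀ a, f a ∈ closure (f '' D) := by
  let _ : TopologicalSpace α := TopologicalSpace.induced f inferInstance
  have : SecondCountableTopology α := TopologicalSpace.secondCountableTopology_induced α β f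
  obtain ⟨D, hD, hDd⟩ := TopologicalSpace.exists_countable_dense α
  exact ⟨D, hD, fun a => closure_induced.1 (hDd a)⟩

theorem tendsto_of_lipschitzWith_of_tendsto_ratCast {X : Type*} [PseudoMetricSpace X] {C : NNReal}
    {f : ℝ → X} {F : ℕ → ℝ → X} (hf : LipschitzWith C f) (hF : ∀ n, LipschitzWith C (F n))
    (h : ∀ q : ℚ, Tendsto (fun n => F n q) atTop (𝓝 (f q))) (t : ℝ) :
    Tendsto (fun n => F n t) atTop (𝓝 (f t)) := by
  rw [Metric.tendsto_atTop]
  intro ε hε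
  obtain ⟨q, hq⟩ := Rat.denseRange_cast.exists_dist_lt t
    (show (0 : ℝ) < ε / (4 * (C + 1)) by positivity)
  have hCq : C * dist t q < ε / 3 := by
    rw [lt_div_iff₀ (by positivity)] at hq
    have h0 : 0 ≤ dist t (q : ℝ) := dist_nonneg
    nlinarith
  obtain ⟨N, hN⟩ := Metric.tendsto_atTop.1 (h q) (ε / 3) (by positivity)
  refine ⟨N, fun n hn => ?_⟩
  have h1 := dist_triangle4 (F n t) (F n q) (f q) (f t)
  have h2 := (hF n).dist_le_mul t q
  have h3 := hf.dist_le_mul q t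
  rw [dist_comm (q : ℝ) t] at h3
  linarith [hN n hn]

theorem LipschitzWith.edist_limUnder_comap_le {α β : Type*} [PseudoEMetricSpace α]
    [PseudoEMetricSpace β] [CompleteSpace β] [Nonempty β] {C : NNReal} {s : Set α} {f : s → β}
    (hf : LipschitzWith C f) {a : α} (ha : a ∈ closure s) (x : s) :
    edist (limUnder (comap ((↑) : s → α) (𝓝 a)) f) (f x) ≤ C * edist a (x : α) := by
  have hne : (comap ((↑) : s → α) (𝓝 a)).NeBot := mem_closure_iff_comap_neBot.1 ha
  have hcauchy : Cauchy (comap ((↑) : s → α) (𝓝 a)) :=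
    cauchy_nhds.comap (by rw [uniformity_subtype])
  have hlim : Tendsto f (comap ((↑) : s → α) (𝓝 a))
      (𝓝 (limUnder (comap ((↑) : s → α) (𝓝 a)) f)) :=
    tendsto_nhds_limUnder (CompleteSpace.complete (hcauchy.map hf.uniformContinuous))
  have h1 : Tendsto (fun y => edist (f y) (f x)) (comap ((↑) : s → α) (𝓝 a))
      (𝓝 (edist (limUnder (comap ((↑) : s → α) (𝓝 a)) f) (f x))) :=
    hlim.edist tendsto_const_nhds
  have h2 : Tendsto (fun y : s => (C : ℝ≥0∞) * edist (y : α) (x : α))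
      (comap ((↑) : s → α) (𝓝 a)) (𝓝 (C * edist a (x : α))) :=
    ENNReal.Tendsto.const_mul (tendsto_comap.edist tendsto_const_nhds)
      (Or.inr ENNReal.coe_ne_top)
  exact le_of_tendsto_of_tendsto' h1 h2 fun y => hf y x

namespace FilippovSystem.OrbitSpace

section Extension

variable {E : Type*} [NormedAddCommGroup E] [NormedSpace ℝ E]
  {H : Type*} [TopologicalSpace H] {I : ModelWithCorners ℝ E H}
  {M : Type*} [MetricSpace M] [CompleteSpace M] [ChartedSpace H M] [IsManifold I ∞ M] {r : ℕ∞}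
  {Z : FilippovSystem I M r} {C : NNReal}

theorem lipschitzWith_extend {γ : Z.OrbitSpace} (hγ : LipschitzWith C γ.curve) :
    LipschitzWith C γ.extend := by
  classical
  have : Nonempty M := γ.nonempty_target
  obtain ⟨g, -, hg, -⟩ := γ.exists_maximal
  have hoc := hg.ordConnected
  obtain ⟨x₀, hx₀⟩ := hg.nontrivial.nonempty
  set L := limUnder (comap ((↑) : γ.domain → ℝ) (𝓝 (sInf γ.domain))) γ.curve with hL
  set R := limUnder (comap ((↑) : γ.domain → ℝ) (𝓝 (sSup γ.domain))) γ.curve with hR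
  have hcase : ∀ t, (∃ ht : t ∈ γ.domain, γ.extend t = γ.curve ⟨t, ht⟩) ∨
      ((∀ x ∈ γ.domain, t < x) ∧ γ.extend t = L) ∨
      ((∀ x ∈ γ.domain, x < t) ∧ γ.extend t = R) := by
    intro t
    by_cases ht : t ∈ γ.domain
    · exact Or.inl ⟨ht, by simp [extend, ht]⟩
    · by_cases hl : ∀ x ∈ γ.domain, t < x
      · exact Or.inr (Or.inl ⟨hl, by simp only [extend, dif_neg ht, if_pos hl, hL]⟩)
      · refine Or.inr (Or.inr ⟨fun x hx => ?_, by simp only [extend, dif_neg ht, if_neg hl, hR]⟩)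
        push Not at hl
        obtain ⟨y, hy, hyt⟩ := hl
        by_contra! hxt
        exact ht (hoc.out hy hx ⟨hyt, hxt⟩)
  have hLle : ∀ t, (∀ x ∈ γ.domain, t < x) → ∀ x : γ.domain,
      edist L (γ.curve x) ≤ C * ENNReal.ofReal (x - t) := by
    intro t ht x
    have hb : BddBelow γ.domain := ⟨t, fun y hy => (ht y hy).le⟩
    refine (hγ.edist_limUnder_comap_le (csInf_mem_closure ⟨x₀, hx₀⟩ hb) x).trans ?_
    gcongr
    rw [edist_comm, edist_dist, Real.dist_eq, abs_of_nonneg (sub_nonneg.2 (csInf_le hb x.2))]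
    exact ENNReal.ofReal_le_ofReal
      (sub_le_sub_left (le_csInf ⟨x₀, hx₀⟩ fun y hy => (ht y hy).le) _)
  have hRle : ∀ t, (∀ x ∈ γ.domain, x < t) → ∀ x : γ.domain,
      edist R (γ.curve x) ≤ C * ENNReal.ofReal (t - x) := by
    intro t ht x
    have hb : BddAbove γ.domain := ⟨t, fun y hy => (ht y hy).le⟩
    refine (hγ.edist_limUnder_comap_le (csSup_mem_closure ⟨x₀, hx₀⟩ hb) x).trans ?_
    gcongr
    rw [edist_dist, Real.dist_eq, abs_of_nonneg (sub_nonneg.2 (le_csSup hb x.2))]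
    exact ENNReal.ofReal_le_ofReal
      (sub_le_sub_right (csSup_le ⟨x₀, hx₀⟩ fun y hy => (ht y hy).le) _)
  have key : ∀ t u, t ≤ u → edist (γ.extend t) (γ.extend u) ≤ C * ENNReal.ofReal (u - t) := by
    intro t u htu
    rcases hcase t with ⟨ht, et⟩ | ⟨ht, et⟩ | ⟨ht, et⟩ <;>
      rcases hcase u with ⟨hu, eu⟩ | ⟨hu, eu⟩ | ⟨hu, eu⟩ <;> rw [et, eu]
    · refine (hγ _ _).trans_eq ?_
      rw [edist_comm, Subtype.edist_eq, edist_dist, Real.dist_eq, abs_of_nonneg (sub_nonneg.2 htu)]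
    · exact absurd htu (not_le.2 (hu t ht))
    · rw [edist_comm]; exact hRle u hu ⟨t, ht⟩
    · exact hLle t ht ⟨u, hu⟩
    · simp
    · refine (edist_triangle_right _ _ (γ.curve ⟨x₀, hx₀⟩)).trans
        ((add_le_add (hLle t ht ⟨x₀, hx₀⟩) (hRle u hu ⟨x₀, hx₀⟩)).trans_eq ?_)
      rw [← mul_add, ← ENNReal.ofReal_add (sub_nonneg.2 (ht x₀ hx₀).le)
        (sub_nonneg.2 (hu x₀ hx₀).le)]
      congr 2
      ring
    · exact absurd htu (not_le.2 (ht u hu))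
    · exact absurd htu (not_le.2 ((hu x₀ hx₀).trans (ht x₀ hx₀)))
    · simp
  intro t u
  rcases le_total t u with h | h
  · refine (key t u h).trans_eq ?_
    rw [edist_comm, edist_dist, Real.dist_eq, abs_of_nonneg (sub_nonneg.2 h)]
  · rw [edist_comm]
    refine (key u t h).trans_eq ?_
    rw [edist_dist, Real.dist_eq, abs_of_nonneg (sub_nonneg.2 h)]

end Extension

section Weight

theorem tsum_weight_mul_ne_top (A B : ℝ) :
    ∑' i : ℤ, (2 ^ i.natAbs : ℝ≥0∞)⁻¹ * ENNReal.ofReal (A + B * (|(i : ℝ)| + 1)) ≠ ⊤ := by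
  have hnat : Summable fun n : ℕ => (1 / 2 : ℝ) ^ n * (A + B * ((n : ℝ) + 1)) := by
    have h1 := (summable_pow_mul_geometric_of_norm_lt_one 1
      (show ‖(1 / 2 : ℝ)‖ < 1 by norm_num)).mul_left B
    have h2 := (summable_geometric_of_lt_one (show (0 : ℝ) ≤ 1 / 2 by norm_num)
      (by norm_num)).mul_left (A + B)
    refine (h1.add h2).congr fun n => ?_
    ring
  have hint : Summable fun i : ℤ => (1 / 2 : ℝ) ^ i.natAbs * (A + B * (|(i : ℝ)| + 1)) :=
    Summable.of_nat_of_neg (by simpa using hnat) (by simpa using hnat)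
  have hterm : ∀ i : ℤ, (2 ^ i.natAbs : ℝ≥0∞)⁻¹ * ENNReal.ofReal (A + B * (|(i : ℝ)| + 1)) =
      ENNReal.ofReal ((1 / 2 : ℝ) ^ i.natAbs * (A + B * (|(i : ℝ)| + 1))) := by
    intro i
    rw [ENNReal.ofReal_mul (by positivity), ENNReal.ofReal_pow (by norm_num), one_div,
      ENNReal.ofReal_inv_of_pos two_pos, ENNReal.ofReal_ofNat, ENNReal.inv_pow]
  simp_rw [hterm]
  exact hint.tsum_ofReal_ne_top

/-- The measure on the line whose density is `2 ^ (-|i|)` on `(i, i + 1]`. -/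
def weight : Measure ℝ :=
  Measure.sum fun i : ℤ => (2 ^ i.natAbs : ℝ≥0∞)⁻¹ • volume.restrict (Ioc (i : ℝ) (i + 1))

theorem lintegral_weight (f : ℝ → ℝ≥0∞) : ∫⁻ t, f t ∂weight =
    ∑' i : ℤ, (2 ^ i.natAbs : ℝ≥0∞)⁻¹ * ∫⁻ t in Ioc (i : ℝ) (i + 1), f t := by
  simp only [weight, lintegral_sum_measure, lintegral_smul_measure, smul_eq_mul]

theorem lintegral_weight_affine_ne_top (A : ℝ) {B : ℝ} (hB : 0 ≤ B) :
    ∫⁻ t, ENNReal.ofReal (A + B * |t|) ∂weight ≠ ⊤ := by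
  rw [lintegral_weight]
  refine ne_top_of_le_ne_top (tsum_weight_mul_ne_top A B) (ENNReal.tsum_le_tsum fun i => ?_)
  gcongr
  calc ∫⁻ t in Ioc (i : ℝ) (i + 1), ENNReal.ofReal (A + B * |t|)
      ≤ ∫⁻ _ in Ioc (i : ℝ) (i + 1), ENNReal.ofReal (A + B * (|(i : ℝ)| + 1)) := by
        refine setLIntegral_mono measurable_const fun t ht => ?_
        gcongr
        have h1 : |t - i| ≤ 1 := abs_le.2 ⟨by linarith [ht.1], by linarith [ht.2]⟩
        calc |t| = |(i : ℝ) + (t - i)| := by ring_nf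
          _ ≤ |(i : ℝ)| + |t - i| := abs_add_le _ _
          _ ≤ |(i : ℝ)| + 1 := by gcongr
    _ = ENNReal.ofReal (A + B * (|(i : ℝ)| + 1)) := by simp

end Weight

section Separability

variable {E : Type*} [NormedAddCommGroup E] [NormedSpace ℝ E]
  {H : Type*} [TopologicalSpace H] {I : ModelWithCorners ℝ E H}
  {M : Type*} [MetricSpace M] [SecondCountableTopology M] [ChartedSpace H M] [IsManifold I ∞ M]
  {r : ℕ∞} {Z : FilippovSystem I M r} {C : NNReal}

theorem tendsto_edist_zero {γ : Z.OrbitSpace} {δ : ℕ → Z.OrbitSpace}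
    (hγ : LipschitzWith C γ.extend) (hδ : ∀ n, LipschitzWith C (δ n).extend)
    (h : ∀ q : ℚ, Tendsto (fun n => (δ n).extend q) atTop (𝓝 (γ.extend q))) :
    Tendsto (fun n => edist (δ n) γ) atTop (𝓝 0) := by
  have hpt := tendsto_of_lipschitzWith_of_tendsto_ratCast hγ hδ h
  have hedist : ∀ n, edist (δ n) γ = ∫⁻ t, edist ((δ n).extend t) (γ.extend t) ∂weight :=
    fun n => (lintegral_weight _).symm
  obtain ⟨A, hA⟩ := (tendsto_iff_dist_tendsto_zero.1 (hpt 0)).bddAbove_range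
  have hA' : ∀ n, dist ((δ n).extend 0) (γ.extend 0) ≤ A := fun n => hA ⟨n, rfl⟩
  simp_rw [hedist]
  have hlim := tendsto_lintegral_of_dominated_convergence (μ := weight)
    (F := fun n t => edist ((δ n).extend t) (γ.extend t)) (f := fun _ => 0)
    (fun t => ENNReal.ofReal (A + 2 * C * |t|))
    (fun n => ((hδ n).continuous.edist hγ.continuous).measurable) (fun n => ?_)
    (lintegral_weight_affine_ne_top A (B := 2 * C) (by positivity))
    (Eventually.of_forall fun t => tendsto_iff_edist_tendsto_0.1 (hpt t))
  · simpa using hlim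
  · refine Eventually.of_forall fun t => ?_
    simp only [edist_dist]
    refine ENNReal.ofReal_le_ofReal ?_
    have h1 := dist_triangle4 ((δ n).extend t) ((δ n).extend 0) (γ.extend 0) (γ.extend t)
    have h2 := (hδ n).dist_le_mul t 0
    have h3 := hγ.dist_le_mul 0 t
    rw [dist_comm (0 : ℝ) t] at h3
    simp only [Real.dist_eq, sub_zero] at h2 h3
    linarith [hA' n]

theorem separableSpace_of_lipschitzWith_extend
    (hZ : ∀ γ : Z.OrbitSpace, LipschitzWith C γ.extend) :
    TopologicalSpace.SeparableSpace Z.OrbitSpace := by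
  let Φ : Z.OrbitSpace → ℚ → M := fun γ q => γ.extend q
  obtain ⟨D, hD, hDd⟩ := exists_countable_forall_mem_closure_image Φ
  refine ⟨⟨D, hD, fun γ => ?_⟩⟩
  obtain ⟨x, hx, hlim⟩ := mem_closure_iff_seq_limit.1 (hDd γ)
  choose δ hδ hδx using hx
  have hlim' : Tendsto (fun n => Φ (δ n)) atTop (𝓝 (Φ γ)) := by simpa only [hδx] using hlim
  refine mem_closure_of_tendsto (f := δ) (b := atTop) ?_ (Eventually.of_forall hδ)
  rw [tendsto_iff_edist_tendsto_0]
  exact tendsto_edist_zero (hZ γ) (fun n => hZ _) fun q => tendsto_pi_nhds.1 hlim' q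

end Separability

end FilippovSystem.OrbitSpace


end

theorem mainTheorem3
    {E : Type*} [NormedAddCommGroup E] [NormedSpace ℝ E] [FiniteDimensional ℝ E]
    {H : Type*} [TopologicalSpace H] (I : ModelWithCorners ℝ E H)
    {M : Type*} [MetricSpace M] [ChartedSpace H M] [IsManifold I ∞ M]
    [SecondCountableTopology M] [CompleteSpace M]
    [Bundle.RiemannianBundle (fun p : M => TangentSpace I p)]
    [IsContMDiffRiemannianBundle I ∞ E (fun p : M => TangentSpace I p)]
    [IsRiemannianManifold I M]
    (r : ℕ∞) (hr : 1 < r)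
    (Z : FilippovSystem I M r)
    (hZ : Z.IsBounded)
    (hfin : Z.tangency.Finite)
    (hmult : ∀ p ∈ Z.tangency, Z.FiniteMultiplicity p) :
    TopologicalSpace.SeparableSpace Z.OrbitSpace := by
  obtain ⟨C, hC⟩ := hZ
  have hC' : ∀ p, ∀ v ∈ Z.values p, ‖v‖ ≤ C.toNNReal := fun p v hv =>
    (hC p v hv).trans (Real.le_coe_toNNReal C)
  refine FilippovSystem.OrbitSpace.separableSpace_of_lipschitzWith_extend (C := C.toNNReal)
    fun γ => FilippovSystem.OrbitSpace.lipschitzWith_extend ?_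
  obtain ⟨g, hg, hsol, -⟩ := γ.exists_maximal
  have hlip := (hsol.lipschitzOnWith hC' hr.le hfin).to_restrict
  intro x y
  rw [hg x, hg y]
  exact hlip x y
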